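/- Let $\mathbb{C}_0=\{s\in\mathbb{C}:\operatorname{Re}s>0\}$ and let $\mathcal{A}^+$ be the algebra of all functions $f:\mathbb{C}_0\to\mathbb{C}$ of the form $f(s)=\sum_{n=1}^\infty a_n n^{-s}$ with $\sum_{n=1}^\infty|a_n|<\infty$. Let $\varphi:\mathbb{C}_0\to\mathbb{C}_0$ induce a composition operator $C_\varphi:\mathcal{A}^+\to\mathcal{A}^+$, i.e. $f\circ\varphi\in\mathcal{A}^+$ for every $f\in\mathcal{A}^+$. Suppose moreover that $\varphi$ extends to a continuous function $\overline{\mathbb{C}_0}=\{s\in\mathbb{C}:\operatorname{Re}s\ge 0\}\to\mathbb{C}$, still denoted by $\varphi$, with $\varphi(i\mathbb{R})\subseteq i\mathbb{R}$. Then there are $c_0\in\mathbb{N}_0=\{0,1,2,\dots\}$ and $\tau\in\mathbb{R}$ such that $\varphi(s)=c_0s+i\tau$ for all $s\in\mathbb{C}_0$. -/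

import Mathlib

/-- The open right half-plane `ℂ₀ = {s : ℂ | 0 < Re s}`, as a type. -/
abbrev RightHalfPlane : Type := {s : ℂ // 0 < s.re}

/-- The Wiener-Dirichlet algebra `𝒜⁺`, as a set of functions on `ℂ₀`: the sums
`f s = ∑_{n ≥ 1} a n * n ^ (-s)` of the Dirichlet series with `∑ |a n| < ∞`.
(`LSeriesHasSum a s w` says that `∑_{n ≥ 1} a n / n ^ s` converges absolutely to `w`; the term
of index `0` is `0`.) -/
def wienerDirichlet : Set (RightHalfPlane → ℂ) :=
  {f | ∃ a : ℕ → ℂ, Summable (fun n => ‖a n‖) ∧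
    ∀ s : RightHalfPlane, LSeriesHasSum a (s : ℂ) (f s)}

/-- `φ : ℂ₀ → ℂ₀` induces a composition operator `C_φ : 𝒜⁺ → 𝒜⁺`, `C_φ f = f ∘ φ`. -/
def InducesCompositionOperator (φ : RightHalfPlane → RightHalfPlane) : Prop :=
  ∀ f ∈ wienerDirichlet, f ∘ φ ∈ wienerDirichlet

open Complex ComplexConjugate Filter Metric Set Topology

/-!
Applying `C_φ` to `2 ^ (-s)` shows that `φ` is holomorphic. Since `φ` maps `iℝ` into itself, Schwarz
reflection extends it to an entire function `F` preserving both closed half-planes. On the circle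
`|s| = R` we have `s ^ 2 + R ^ 2 = 2 s Re s`, so the entire function
`(F s - F 0) / s * (s ^ 2 + R ^ 2)` has real part `2 Re s Re (F s) ≥ 0` there; the
Borel–Carathéodory inequality then bounds `(F s - F 0) / s` independently of `R`, and Liouville's
theorem gives `F s = c s + iτ` with `c` real. Finally `|n ^ (-φ x)| = (n ^ c) ^ (-x)` is the
absolute value of a Dirichlet series, and comparing with its leading term shows that `n ^ c` is an
integer. If this holds for all `n`, then `c ∈ ℕ`: otherwise the `k`-th difference of `n ^ c` with
`k > c` is nonzero, integral and tends to `0`.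
-/

section NatPower

theorem exists_mem_Icc_fwdDiff_iter_eq {δ : ℝ} (hδ : 0 < δ) (k : ℕ) {f : ℕ → ℝ → ℝ} {x : ℝ}
    (hf : ∀ i < k, ∀ y ∈ Icc x (x + k * δ), HasDerivAt (f i) (f (i + 1) y) y) :
    ∃ ξ ∈ Icc x (x + k * δ), (fwdDiff δ)^[k] (f 0) x = δ ^ k * f k ξ := by
  induction k generalizing f with
  | zero => exact ⟨x, by simp, by simp⟩
  | succ k ih =>
    have hlen : x + (k + 1 : ℕ) * δ = x + k * δ + δ := by push_cast; ring
    rw [hlen] at hf ⊢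
    obtain ⟨ξ, hξ, hξf⟩ := ih (f := fun i => fwdDiff δ (f i)) fun i hi y hy =>
      ((hf i (by omega) (y + δ) ⟨by linarith [hy.1], by linarith [hy.2]⟩).comp_add_const y δ).sub
        (hf i (by omega) y ⟨hy.1, by linarith [hy.2]⟩)
    have hderiv : ∀ y ∈ Icc ξ (ξ + δ), HasDerivAt (f k) (f (k + 1) y) y := fun y hy =>
      hf k k.lt_succ_self y ⟨hξ.1.trans hy.1, by linarith [hy.2, hξ.2]⟩
    obtain ⟨η, hη, hηf⟩ := exists_hasDerivAt_eq_slope (f k) (f (k + 1)) (lt_add_of_pos_right ξ hδ)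
      (fun y hy => (hderiv y hy).continuousAt.continuousWithinAt)
      fun y hy => hderiv y (Ioo_subset_Icc_self hy)
    refine ⟨η, ⟨hξ.1.trans hη.1.le, by linarith [hη.2, hξ.2]⟩, ?_⟩
    rw [Function.iterate_succ_apply, hξf, hηf, fwdDiff, add_sub_cancel_left, pow_succ, mul_assoc,
      mul_div_cancel₀ _ hδ.ne']

theorem fwdDiff_iter_mem {M G : Type*} [AddCommMonoid M] [AddCommGroup G] {H : AddSubgroup G}
    {δ x : M} {f : M → G} {k : ℕ} (hf : ∀ j ≤ k, f (x + j • δ) ∈ H) :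
    (fwdDiff δ)^[k] f x ∈ H := by
  rw [fwdDiff_iter_eq_sum_shift]
  exact sum_mem fun j hj => zsmul_mem (hf j (Finset.mem_range_succ_iff.1 hj)) _

theorem hasDerivAt_descPochhammer_eval_mul_rpow (c : ℝ) (k : ℕ) {x : ℝ} (hx : x ≠ 0) :
    HasDerivAt (fun x : ℝ => (descPochhammer ℝ k).eval c * x ^ (c - k))
      ((descPochhammer ℝ (k + 1)).eval c * x ^ (c - (k + 1 : ℕ))) x := by
  refine ((Real.hasDerivAt_rpow_const (p := c - k) (Or.inl hx)).const_mul _).congr_deriv ?_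
  rw [descPochhammer_succ_eval, Nat.cast_succ, ← sub_sub, mul_assoc]

theorem exists_nat_eq_of_eventually_rpow_mem_range_intCast {c : ℝ}
    (h : ∀ᶠ n : ℕ in atTop, (n : ℝ) ^ c ∈ range ((↑) : ℤ → ℝ)) : ∃ k : ℕ, c = k := by
  by_contra! hne
  obtain ⟨k, hck⟩ := exists_nat_gt c
  let f : ℕ → ℝ → ℝ := fun i x => (descPochhammer ℝ i).eval c * x ^ (c - i)
  have hf0 : f 0 = fun x => x ^ c := by simp [f]
  have hcoeff : (descPochhammer ℝ k).eval c ≠ 0 := by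
    rw [descPochhammer_eval_eq_prod_range, Finset.prod_ne_zero_iff]
    exact fun j _ => sub_ne_zero.2 (hne j)
  have hlim : Tendsto (f k) atTop (𝓝 0) := by
    simpa [f] using (tendsto_rpow_neg_atTop (sub_pos.2 hck)).const_mul ((descPochhammer ℝ k).eval c)
  obtain ⟨X, hX⟩ := eventually_atTop.1 (hlim.norm.eventually_lt_const (by simp : ‖(0 : ℝ)‖ < 1))
  obtain ⟨N, hN⟩ := eventually_atTop.1 h
  obtain ⟨n, hn⟩ := exists_nat_ge (max X (max N 1))
  obtain ⟨hXn, hNn, hn1⟩ : X ≤ n ∧ N ≤ n ∧ (1 : ℝ) ≤ n := by simpa using hn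
  obtain ⟨ξ, hξ, hdiff⟩ := exists_mem_Icc_fwdDiff_iter_eq one_pos k (f := f) (x := n)
    fun i _ y hy => hasDerivAt_descPochhammer_eval_mul_rpow c i
      (by linarith [hy.1] : (0 : ℝ) < y).ne'
  obtain ⟨m, hm⟩ : ∃ m : ℤ, (m : ℝ) = (fwdDiff 1)^[k] (f 0) (n : ℝ) := by
    refine fwdDiff_iter_mem (H := (Int.castAddHom ℝ).range) fun j _ => ?_
    rw [hf0, nsmul_one, ← Nat.cast_add]
    exact hN (n + j) (by omega)
  rw [one_pow, one_mul, ← hm] at hdiff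
  have hm0 : m = 0 := by
    have hlt := hX ξ (hXn.trans hξ.1)
    rw [← hdiff, Int.norm_cast_real, Int.norm_eq_abs, ← Int.cast_abs] at hlt
    exact Int.abs_lt_one_iff.1 (by exact_mod_cast hlt)
  have hξ0 : 0 < ξ := by linarith [hξ.1]
  refine mul_ne_zero hcoeff (Real.rpow_pos_of_pos hξ0 (c - k)).ne' ?_
  rw [← Int.cast_zero, ← hm0, hdiff]

end NatPower

section LeadingTerm

theorem eq_one_of_tendsto_rpow_atTop {r l : ℝ} (hr : 0 < r) (hl : l ≠ 0)
    (h : Tendsto (fun x : ℝ => r ^ x) atTop (𝓝 l)) : r = 1 := by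
  have hshift : Tendsto (fun x : ℝ => r ^ (x + 1)) atTop (𝓝 l) :=
    h.comp (tendsto_atTop_add_const_right _ 1 tendsto_id)
  have hmul : Tendsto (fun x : ℝ => r ^ (x + 1)) atTop (𝓝 (l * r)) :=
    (h.mul_const r).congr fun x => (Real.rpow_add_one hr.ne' x).symm
  exact mul_left_cancel₀ hl ((tendsto_nhds_unique hmul hshift).trans (mul_one l).symm)

theorem exists_nat_eq_of_norm_LSeries_eq_rpow_neg {a : ℕ → ℂ}
    (ha : LSeries.abscissaOfAbsConv a < ⊤) {b : ℝ} (hb : 0 < b)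
    (h : ∀ᶠ x : ℝ in atTop, ‖LSeries a x‖ = b ^ (-x)) : ∃ m : ℕ, b = m := by
  wlog ha0 : a 0 = 0 generalizing a
  · have hcongr : ∀ {n}, n ≠ 0 → Function.update a 0 0 n = a n := fun hn =>
      Function.update_of_ne hn _ _
    exact this (by rwa [LSeries.abscissaOfAbsConv_congr hcongr])
      (by simpa only [LSeries_congr hcongr] using h) (Function.update_self _ _ _)
  have hex : ∃ k, a k ≠ 0 := by
    by_contra! hzero
    obtain ⟨x, hx⟩ := h.exists
    rw [show a = 0 from funext hzero, LSeries_zero, Pi.zero_apply, norm_zero] at hx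
    exact (Real.rpow_pos_of_pos hb _).ne hx
  classical
  obtain ⟨m, hm⟩ := Nat.exists_eq_succ_of_ne_zero
    (fun hfind : Nat.find hex = 0 => Nat.find_spec hex (hfind ▸ ha0))
  have hlead : a (m + 1) ≠ 0 := by
    rw [← Nat.succ_eq_add_one, ← hm]
    exact Nat.find_spec hex
  have hbelow : ∀ k ≤ m, a k = 0 := fun k hk =>
    not_not.1 (Nat.find_min hex (hm ▸ Nat.lt_succ_of_le hk))
  have hlim : Tendsto (fun x : ℝ => ((m + 1 : ℕ) / b) ^ x) atTop (𝓝 ‖a (m + 1)‖) := by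
    refine (LSeries.tendsto_cpow_mul_atTop hbelow ha).norm.congr' ?_
    filter_upwards [h] with x hx
    rw [norm_mul, hx, ← Nat.cast_succ, norm_natCast_cpow_of_pos m.succ_pos, ofReal_re,
      Real.rpow_neg hb.le, ← div_eq_mul_inv, Real.div_rpow (Nat.cast_nonneg _) hb.le]
  have hone := eq_one_of_tendsto_rpow_atTop (by positivity) (norm_ne_zero_iff.2 hlead) hlim
  exact ⟨m + 1, ((div_eq_one_iff_eq hb.ne').1 hone).symm⟩

end LeadingTerm

section RemovableLine

variable {E : Type*} [NormedAddCommGroup E] [NormedSpace ℂ E] {f : ℂ → E}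

theorem wedgeIntegral_add_swap_split (hf : Continuous f) (z w : ℂ) (c : ℝ) :
    wedgeIntegral z w f + wedgeIntegral w z f =
      (wedgeIntegral z ⟨c, w.im⟩ f + wedgeIntegral ⟨c, w.im⟩ z f) +
        (wedgeIntegral ⟨c, z.im⟩ w f + wedgeIntegral w ⟨c, z.im⟩ f) := by
  have hint (y a b : ℝ) :
      IntervalIntegrable (fun x : ℝ => f (x + y * I)) MeasureTheory.volume a b :=
    Continuous.intervalIntegrable (by fun_prop) a b
  simp only [wedgeIntegral_add_wedgeIntegral_eq]
  rw [← intervalIntegral.integral_add_adjacent_intervals (hint z.im z.re c) (hint z.im c w.re),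
    ← intervalIntegral.integral_add_adjacent_intervals (hint w.im z.re c) (hint w.im c w.re)]
  abel

theorem wedgeIntegral_add_swap_eq_zero_of_re_eq {c : ℝ} (hf : Continuous f)
    (hd : ∀ z : ℂ, z.re ≠ c → DifferentiableAt ℂ f z) {z w : ℂ} (h : z.re = c ∨ w.re = c) :
    wedgeIntegral z w f + wedgeIntegral w z f = 0 := by
  rw [wedgeIntegral_add_wedgeIntegral_eq]
  refine integral_boundary_rect_eq_zero_of_continuousOn_of_differentiableOn f z w hf.continuousOn
    fun s hs => (hd s fun hsc => ?_).differentiableWithinAt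
  obtain ⟨hmin, hmax⟩ : min z.re w.re < s.re ∧ s.re < max z.re w.re := hs.1
  grind

theorem differentiable_of_continuous_of_re_ne [CompleteSpace E] {c : ℝ} (hf : Continuous f)
    (hd : ∀ z : ℂ, z.re ≠ c → DifferentiableAt ℂ f z) : Differentiable ℂ f := by
  rw [← differentiableOn_univ,
    ← isConservativeOn_and_continuousOn_iff_isDifferentiableOn isOpen_univ]
  refine ⟨fun z w _ => ?_, hf.continuousOn⟩
  rw [← add_eq_zero_iff_eq_neg, wedgeIntegral_add_swap_split hf z w c,
    wedgeIntegral_add_swap_eq_zero_of_re_eq hf hd (Or.inr rfl),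
    wedgeIntegral_add_swap_eq_zero_of_re_eq hf hd (Or.inl rfl), add_zero]

end RemovableLine

/-- The extension of a function on the closed right half-plane to `ℂ` by Schwarz reflection in the
imaginary axis, `s ↦ -conj s`. The values of `Φ` on the open left half-plane are ignored. -/
noncomputable def schwarzExtension (Φ : ℂ → ℂ) (s : ℂ) : ℂ :=
  if 0 ≤ s.re then Φ s else -conj (Φ (-conj s))

section SchwarzExtension

variable {Φ : ℂ → ℂ}

theorem schwarzExtension_of_re_nonneg {s : ℂ} (hs : 0 ≤ s.re) : schwarzExtension Φ s = Φ s :=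
  if_pos hs

theorem schwarzExtension_of_re_nonpos (h0 : ∀ s : ℂ, s.re = 0 → (Φ s).re = 0) {s : ℂ}
    (hs : s.re ≤ 0) : schwarzExtension Φ s = -conj (Φ (-conj s)) := by
  rcases hs.lt_or_eq with hs | hs
  · exact if_neg hs.not_ge
  · have hfix : -conj s = s := Complex.ext (by simp [hs]) (by simp)
    rw [schwarzExtension_of_re_nonneg hs.ge, hfix]
    exact Complex.ext (by simp [h0 s hs]) (by simp)

theorem continuous_schwarzExtension (hΦ : ContinuousOn Φ {s | 0 ≤ s.re})
    (h0 : ∀ s : ℂ, s.re = 0 → (Φ s).re = 0) : Continuous (schwarzExtension Φ) := by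
  have hright : ContinuousOn (schwarzExtension Φ) {s | 0 ≤ s.re} :=
    hΦ.congr fun s hs => schwarzExtension_of_re_nonneg hs
  have hleft : ContinuousOn (schwarzExtension Φ) {s | s.re ≤ 0} := by
    refine ContinuousOn.congr ?_ fun s hs => schwarzExtension_of_re_nonpos h0 hs
    refine (continuous_conj.comp_continuousOn (hΦ.comp (by fun_prop) fun s hs => ?_)).neg
    simpa using hs
  rw [← continuousOn_univ]
  refine (hright.union_of_isClosed hleft (isClosed_le continuous_const continuous_re)
    (isClosed_le continuous_re continuous_const)).mono fun s _ => le_total 0 s.re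

theorem differentiable_schwarzExtension (hΦ : ContinuousOn Φ {s | 0 ≤ s.re})
    (hd : ∀ s : ℂ, 0 < s.re → DifferentiableAt ℂ Φ s) (h0 : ∀ s : ℂ, s.re = 0 → (Φ s).re = 0) :
    Differentiable ℂ (schwarzExtension Φ) := by
  refine differentiable_of_continuous_of_re_ne (c := 0) (continuous_schwarzExtension hΦ h0)
    fun s hs => ?_
  rcases hs.lt_or_gt with hs | hs
  · have hneg : DifferentiableAt ℂ (fun z => Φ (-z)) (conj s) :=
      (hd (-conj s) (by simpa using hs)).comp _ differentiable_neg.differentiableAt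
    have hconj := hneg.conj_conj
    rw [conj_conj] at hconj
    refine hconj.neg.congr_of_eventuallyEq ?_
    filter_upwards [(isOpen_lt continuous_re continuous_const).mem_nhds hs] with z hz
    exact schwarzExtension_of_re_nonpos h0 (le_of_lt hz)
  · refine (hd s hs).congr_of_eventuallyEq ?_
    filter_upwards [(isOpen_lt continuous_const continuous_re).mem_nhds hs] with z hz
    exact schwarzExtension_of_re_nonneg (le_of_lt hz)

end SchwarzExtension

theorem re_le_of_forall_mem_frontier_re_le {E : Type*} [NormedAddCommGroup E] [NormedSpace ℂ E]
    [Nontrivial E] {U : Set E} (hU : Bornology.IsBounded U) {f : E → ℂ} (hf : DiffContOnCl ℂ f U)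
    {M : ℝ} (hM : ∀ z ∈ frontier U, (f z).re ≤ M) {z : E} (hz : z ∈ closure U) : (f z).re ≤ M := by
  have hexp := norm_le_of_forall_mem_frontier_norm_le hU (differentiable_exp.comp_diffContOnCl hf)
    (C := Real.exp M) (fun w hw => by simpa [norm_exp] using hM w hw) hz
  simpa [norm_exp] using hexp

theorem differentiable_dslope {E : Type*} [NormedAddCommGroup E] [NormedSpace ℂ E]
    [CompleteSpace E] {f : ℂ → E} (hf : Differentiable ℂ f) (c : ℂ) :
    Differentiable ℂ (dslope f c) :=
  differentiableOn_univ.1 ((differentiableOn_dslope univ_mem).2 hf.differentiableOn)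

section PreservesHalfPlanes

variable {F : ℂ → ℂ}

theorem re_dslope_mul_sq_add_sq_nonneg (hr : ∀ s : ℂ, 0 ≤ s.re → 0 ≤ (F s).re)
    (hl : ∀ s : ℂ, s.re ≤ 0 → (F s).re ≤ 0) (s : ℂ) :
    0 ≤ (dslope F 0 s * (s ^ 2 + (‖s‖ : ℂ) ^ 2)).re := by
  have hF0 : (F 0).re = 0 := le_antisymm (hl 0 le_rfl) (hr 0 le_rfl)
  have hsq : s ^ 2 + (‖s‖ : ℂ) ^ 2 = s * (2 * s.re : ℝ) := by
    rw [← mul_conj', ← add_conj]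
    ring
  have hslope : s * dslope F 0 s = F s - F 0 := by simpa using sub_smul_dslope F 0 s
  rw [hsq, ← mul_assoc, mul_comm _ s, hslope, re_mul_ofReal, sub_re, hF0, sub_zero]
  rcases le_total 0 s.re with hs | hs
  · exact mul_nonneg (hr s hs) (by positivity)
  · exact mul_nonneg_of_nonpos_of_nonpos (hl s hs) (by linarith)

theorem norm_dslope_le_of_preserves_halfPlanes (hF : Differentiable ℂ F)
    (hr : ∀ s : ℂ, 0 ≤ s.re → 0 ≤ (F s).re) (hl : ∀ s : ℂ, s.re ≤ 0 → (F s).re ≤ 0) (s : ℂ) :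
    ‖dslope F 0 s‖ ≤ 4 * (1 + ‖deriv F 0‖) := by
  obtain ⟨R, hR, hsR⟩ : ∃ R : ℝ, 0 < R ∧ 2 * ‖s‖ ≤ R := ⟨2 * ‖s‖ + 1, by positivity, by linarith⟩
  let G : ℂ → ℂ := fun z => dslope F 0 z * (z ^ 2 + (R : ℂ) ^ 2)
  have hG : Differentiable ℂ (fun z => -G z) := by
    have hdslope := differentiable_dslope hF 0
    fun_prop
  have hre : ∀ z ∈ ball (0 : ℂ) R, (-G z).re ≤ R ^ 2 := fun z hz => by
    refine re_le_of_forall_mem_frontier_re_le isBounded_ball hG.diffContOnCl (fun w hw => ?_)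
      (subset_closure hz)
    rw [frontier_ball _ hR.ne', mem_sphere_zero_iff_norm] at hw
    have hnonneg : 0 ≤ (G w).re := by
      simpa only [G, ← hw] using re_dslope_mul_sq_add_sq_nonneg hr hl w
    rw [neg_re]
    nlinarith
  have hG0 : ‖G 0‖ = ‖deriv F 0‖ * R ^ 2 := by simp [G]
  have hGs : ‖G s‖ ≤ 3 * (1 + ‖deriv F 0‖) * R ^ 2 := by
    have hbc := borelCaratheodory (by positivity) hG.differentiableOn hre hR
      (mem_ball_zero_iff.2 (by linarith [norm_nonneg s] : ‖s‖ < R))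
    rw [norm_neg, norm_neg, hG0, ← add_div] at hbc
    refine hbc.trans (div_le_of_le_mul₀ (by linarith [norm_nonneg s]) (by positivity) ?_)
    calc 2 * R ^ 2 * ‖s‖ + ‖deriv F 0‖ * R ^ 2 * (R + ‖s‖)
        ≤ 2 * R ^ 2 * (3 / 2 * (R - ‖s‖)) + ‖deriv F 0‖ * R ^ 2 * (3 * (R - ‖s‖)) := by
          gcongr <;> linarith
      _ = 3 * (1 + ‖deriv F 0‖) * R ^ 2 * (R - ‖s‖) := by ring
  have hlow : 3 / 4 * R ^ 2 ≤ ‖s ^ 2 + (R : ℂ) ^ 2‖ := by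
    have htri := norm_sub_le_norm_add ((R : ℂ) ^ 2) (s ^ 2)
    rw [norm_pow, norm_pow, norm_real, Real.norm_eq_abs, sq_abs, add_comm] at htri
    nlinarith [norm_nonneg s]
  refine le_of_mul_le_mul_right ?_ (by positivity : 0 < 3 / 4 * R ^ 2)
  calc ‖dslope F 0 s‖ * (3 / 4 * R ^ 2) ≤ ‖dslope F 0 s‖ * ‖s ^ 2 + (R : ℂ) ^ 2‖ := by gcongr
    _ = ‖G s‖ := (norm_mul _ _).symm
    _ ≤ 3 * (1 + ‖deriv F 0‖) * R ^ 2 := hGs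
    _ = 4 * (1 + ‖deriv F 0‖) * (3 / 4 * R ^ 2) := by ring

theorem exists_eq_mul_add_of_preserves_halfPlanes (hF : Differentiable ℂ F)
    (hr : ∀ s : ℂ, 0 ≤ s.re → 0 ≤ (F s).re) (hl : ∀ s : ℂ, s.re ≤ 0 → (F s).re ≤ 0) :
    ∃ c τ : ℝ, ∀ s, F s = c * s + I * τ := by
  have hbdd : Bornology.IsBounded (range (dslope F 0)) :=
    isBounded_iff_forall_norm_le.2
      ⟨_, forall_mem_range.2 (norm_dslope_le_of_preserves_halfPlanes hF hr hl)⟩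
  obtain ⟨a, ha⟩ := (differentiable_dslope hF 0).exists_const_forall_eq_of_bounded hbdd
  have haff : ∀ s, F s = a * s + F 0 := fun s => by
    have hslope := sub_smul_dslope F 0 s
    rw [ha, sub_zero, smul_eq_mul] at hslope
    linear_combination -hslope
  have himag : ∀ s : ℂ, s.re = 0 → (F s).re = 0 := fun s hs =>
    le_antisymm (hl s hs.le) (hr s hs.ge)
  have hF0 := himag 0 rfl
  have ha0 : a.im = 0 := by simpa [haff I, hF0] using himag I I_re
  refine ⟨a.re, (F 0).im, fun s => ?_⟩
  rw [haff s, mul_comm I]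
  congr 1
  · rw [conj_eq_iff_re.1 (conj_eq_iff_im.2 ha0)]
  · exact Complex.ext (by simp [hF0]) (by simp)

end PreservesHalfPlanes

theorem exists_eq_mul_add_of_continuousOn_of_re_eq_zero {Φ : ℂ → ℂ}
    (hΦ : ContinuousOn Φ {s | 0 ≤ s.re}) (hd : ∀ s : ℂ, 0 < s.re → DifferentiableAt ℂ Φ s)
    (hpos : ∀ s : ℂ, 0 < s.re → 0 ≤ (Φ s).re) (h0 : ∀ s : ℂ, s.re = 0 → (Φ s).re = 0) :
    ∃ c τ : ℝ, ∀ s : ℂ, 0 ≤ s.re → Φ s = c * s + I * τ := by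
  have hnonneg : ∀ s : ℂ, 0 ≤ s.re → 0 ≤ (Φ s).re := fun s hs =>
    hs.lt_or_eq.elim (hpos s) fun hs => (h0 s hs.symm).ge
  obtain ⟨c, τ, hF⟩ := exists_eq_mul_add_of_preserves_halfPlanes
    (differentiable_schwarzExtension hΦ hd h0)
    (fun s hs => by simpa only [schwarzExtension_of_re_nonneg hs] using hnonneg s hs)
    (fun s hs => by
      simpa [schwarzExtension_of_re_nonpos h0 hs] using hnonneg (-conj s) (by simpa using hs))
  exact ⟨c, τ, fun s hs => by rw [← hF, schwarzExtension_of_re_nonneg hs]⟩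

theorem differentiableAt_of_differentiableAt_cexp {E : Type*} [NormedAddCommGroup E]
    [NormedSpace ℂ E] {g : E → ℂ} {s : E} (hg : ContinuousAt g s)
    (hd : DifferentiableAt ℂ (fun z => exp (g z)) s) : DifferentiableAt ℂ g s := by
  have hlog : DifferentiableAt ℂ (fun z => g s + log (exp (g z - g s))) s := by
    simp only [exp_sub, div_eq_mul_inv]
    refine ((hd.mul_const _).clog ?_).const_add _
    rw [mul_inv_cancel₀ (exp_ne_zero _)]
    exact one_mem_slitPlane
  refine hlog.congr_of_eventuallyEq ?_
  have him : Tendsto (fun z => |(g z - g s).im|) (𝓝 s) (𝓝 0) := by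
    simpa using ((continuous_im.tendsto _).comp (hg.sub (tendsto_const_nhds (x := g s)))).abs
  filter_upwards [him.eventually_lt_const Real.pi_pos] with z hz
  rw [log_exp (abs_lt.1 hz).1 (abs_lt.1 hz).2.le]
  ring

theorem exists_LSeries_eq_of_mem_wienerDirichlet {f : RightHalfPlane → ℂ}
    (hf : f ∈ wienerDirichlet) :
    ∃ a : ℕ → ℂ, LSeries.abscissaOfAbsConv a ≤ (0 : ℝ) ∧
      ∀ s : RightHalfPlane, LSeries a s = f s := by
  obtain ⟨a, -, ha⟩ := hf
  refine ⟨a, ?_, fun s => (ha s).LSeries_eq⟩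
  exact LSeries.abscissaOfAbsConv_le_of_forall_lt_LSeriesSummable fun y hy =>
    (ha ⟨(y : ℂ), by simpa using hy⟩).LSeriesSummable

theorem natCast_cpow_neg_mem_wienerDirichlet {n : ℕ} (hn : n ≠ 0) :
    (fun s : RightHalfPlane => (n : ℂ) ^ (-(s : ℂ))) ∈ wienerDirichlet := by
  have hsingle : ∀ k ≠ n, (Pi.single n 1 : ℕ → ℂ) k = 0 := fun k hk => Pi.single_eq_of_ne hk 1
  refine ⟨Pi.single n 1, summable_of_ne_finset_zero (s := {n}) fun k hk => ?_, fun s => ?_⟩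
  · rw [hsingle k (by simpa using hk), norm_zero]
  · have hterm : LSeries.term (Pi.single n 1) s n = (n : ℂ) ^ (-(s : ℂ)) := by
      rw [LSeries.term_of_ne_zero hn, Pi.single_eq_same, one_div, cpow_neg]
    have hsum := hasSum_single (f := LSeries.term (Pi.single n 1) s) n fun k hk => by
      simp [LSeries.term_def, hsingle k hk]
    rwa [hterm] at hsum

namespace InducesCompositionOperator

variable {φ : RightHalfPlane → RightHalfPlane}

theorem exists_LSeries_eq_natCast_cpow_neg (hφ : InducesCompositionOperator φ) {n : ℕ}
    (hn : n ≠ 0) :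
    ∃ a : ℕ → ℂ, LSeries.abscissaOfAbsConv a ≤ (0 : ℝ) ∧
      ∀ s : RightHalfPlane, LSeries a s = (n : ℂ) ^ (-(φ s : ℂ)) :=
  exists_LSeries_eq_of_mem_wienerDirichlet (hφ _ (natCast_cpow_neg_mem_wienerDirichlet hn))

theorem differentiableAt (hφ : InducesCompositionOperator φ) {Φ : ℂ → ℂ}
    (hΦφ : ∀ s : RightHalfPlane, Φ s = φ s) {s : ℂ} (hs : 0 < s.re) (hΦ : ContinuousAt Φ s) :
    DifferentiableAt ℂ Φ s := by
  obtain ⟨a, ha, hLa⟩ := hφ.exists_LSeries_eq_natCast_cpow_neg two_ne_zero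
  have hL : DifferentiableAt ℂ (LSeries a) s :=
    (LSeries_hasDerivAt (ha.trans_lt (by exact_mod_cast hs))).differentiableAt
  have hexp : DifferentiableAt ℂ (fun z => exp (-log 2 * Φ z)) s := by
    refine hL.congr_of_eventuallyEq ?_
    filter_upwards [(isOpen_lt continuous_const continuous_re).mem_nhds hs] with z hz
    rw [hLa ⟨z, hz⟩, ← hΦφ, Nat.cast_ofNat, cpow_def_of_ne_zero two_ne_zero, mul_neg, neg_mul]
  have hlog : log 2 ≠ 0 := by
    rw [← ofReal_ofNat, ← ofReal_log zero_le_two, ofReal_ne_zero]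
    exact (Real.log_pos one_lt_two).ne'
  simpa [hlog] using
    (differentiableAt_of_differentiableAt_cexp (hΦ.const_mul _) hexp).const_mul (-log 2)⁻¹

theorem exists_nat_eq_rpow (hφ : InducesCompositionOperator φ) {c τ : ℝ}
    (h : ∀ s : RightHalfPlane, (φ s : ℂ) = c * s + I * τ) {n : ℕ} (hn : n ≠ 0) :
    ∃ m : ℕ, (n : ℝ) ^ c = m := by
  obtain ⟨a, ha, hLa⟩ := hφ.exists_LSeries_eq_natCast_cpow_neg hn
  refine exists_nat_eq_of_norm_LSeries_eq_rpow_neg (ha.trans_lt (EReal.coe_lt_top 0))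
    (by positivity) ?_
  filter_upwards [eventually_gt_atTop 0] with x hx
  rw [hLa ⟨x, by simpa using hx⟩, norm_natCast_cpow_of_pos (Nat.pos_of_ne_zero hn), h,
    ← Real.rpow_mul n.cast_nonneg]
  simp

end InducesCompositionOperator

theorem theorem5p2 (φ : RightHalfPlane → RightHalfPlane)
    (hφ : InducesCompositionOperator φ)
    (hext : ∃ Φ : ℂ → ℂ, ContinuousOn Φ {s : ℂ | 0 ≤ s.re} ∧
      (∀ s : RightHalfPlane, Φ (s : ℂ) = (φ s : ℂ)) ∧
      (∀ s : ℂ, s.re = 0 → (Φ s).re = 0)) :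
    ∃ (c₀ : ℕ) (τ : ℝ), ∀ s : RightHalfPlane,
      (φ s : ℂ) = (c₀ : ℂ) * (s : ℂ) + Complex.I * (τ : ℂ) := by
  obtain ⟨Φ, hΦ, hΦφ, h0⟩ := hext
  have hd : ∀ s : ℂ, 0 < s.re → DifferentiableAt ℂ Φ s := fun s hs =>
    hφ.differentiableAt hΦφ hs <| hΦ.continuousAt <|
      mem_of_superset ((isOpen_lt continuous_const continuous_re).mem_nhds hs)
        fun z (hz : 0 < z.re) => hz.le
  have hpos : ∀ s : ℂ, 0 < s.re → 0 ≤ (Φ s).re := fun s hs => by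
    rw [hΦφ ⟨s, hs⟩]
    exact (φ ⟨s, hs⟩).2.le
  obtain ⟨c, τ, hcτ⟩ := exists_eq_mul_add_of_continuousOn_of_re_eq_zero hΦ hd hpos h0
  have hφcτ : ∀ s : RightHalfPlane, (φ s : ℂ) = c * s + I * τ := fun s => by
    rw [← hΦφ s, hcτ _ s.2.le]
  obtain ⟨c₀, rfl⟩ : ∃ c₀ : ℕ, c = c₀ := by
    refine exists_nat_eq_of_eventually_rpow_mem_range_intCast ?_
    filter_upwards [eventually_ne_atTop 0] with n hn
    obtain ⟨m, hm⟩ := hφ.exists_nat_eq_rpow hφcτ hn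
    exact ⟨m, by rw [hm, Int.cast_natCast]⟩
  exact ⟨c₀, τ, fun s => by rw [hφcτ, ofReal_natCast]⟩
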